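/- Let $A$ be an infinite dimensional simple separable unital C*-algebra. Two projections $e, f$ are Murray-von Neumann equivalent in $A$ if there is $w \in A$ with $w^* w = e$ and $w w^* = f$. An automorphism $\alpha \in \mathrm{Aut}(A)$ is called tracially approximately inner if for every finite set $F \subset A$, every $\varepsilon > 0$, and every positive element $x \in A$ with $\|x\| = 1$, there exist $p_1, p_2, v \in A$ such that: 1. $p_1$ and $p_2$ are projections, $v^* v = p_1$, and $v v^* = \alpha(p_2)$; 2. $\|p_1 a - a p_1\| < \varepsilon$ and $\|p_2 a - a p_2\| < \varepsilon$ for all $a \in F$; 3. $\|v p_1 a p_1 v^* - \alpha(p_2 a p_2)\| < \varepsilon$ for all $a \in F$; 4. $1 - p_1$ and $1 - p_2$ are Murray-von Neumann equivalent in $A$ to projections in $\overline{x A x}$; 5. $\|p_1 x p_1\| > 1 - \varepsilon$ and $\|p_2 x p_2\| > 1 - \varepsilon$. Order $K_0(A)$ by declaring $\eta \leq \mu$ when $\mu - \eta$ is the class of a projection in some matrix algebra $M_n(A)$; this is a translation-invariant preorder (a partial order when $A$ is stably finite). Call $\eta \in K_0(A)$ infinitesimal if $-m [1_A] \leq n \eta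 \leq m [1_A]$ for all natural numbers $m, n$ with $m > 0$. If $\alpha \in \mathrm{Aut}(A)$ is tracially approximately inner, then $\alpha_*(\eta) - \eta$ is infinitesimal for every $\eta \in K_0(A)$. -/

import Mathlib

/-- A (unital) C*-algebra is simple if it is nonzero and its only closed two-sided ideals are
`0` and the whole algebra. -/
def IsSimpleCStar (A : Type*) [CStarAlgebra A] : Prop :=
  Nontrivial A ∧ ∀ I : TwoSidedIdeal A, IsClosed (I : Set A) → I = ⊥ ∨ I = ⊤

/-- Murray-von Neumann equivalence of elements of `A` (used for projections). -/
def MvNEquiv {A : Type*} [Mul A] [Star A] (p q : A) : Prop :=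
  ∃ w : A, star w * w = p ∧ w * star w = q

/-- The closure of `x A x`. For `x ≥ 0` this is the hereditary subalgebra generated by `x`. -/
def hereditaryClosure {A : Type*} [CStarAlgebra A] (x : A) : Set A :=
  closure (Set.range fun a : A => x * a * x)

/-- `p` is Murray-von Neumann equivalent in `A` to a projection in the closure of `x A x`. -/
def MvNEquivInHereditary {A : Type*} [CStarAlgebra A] (p x : A) : Prop :=
  ∃ q : A, IsStarProjection q ∧ q ∈ hereditaryClosure x ∧ MvNEquiv p q

/-- Tracially approximately inner automorphisms. -/
def IsTraciallyApproxInner {A : Type*} [CStarAlgebra A] [PartialOrder A] [StarOrderedRing A]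
    (α : A ≃⋆ₐ[ℂ] A) : Prop :=
  ∀ (F : Finset A) (ε : ℝ), 0 < ε → ∀ x : A, 0 ≤ x → ‖x‖ = 1 →
    ∃ p₁ p₂ v : A,
      (IsStarProjection p₁ ∧ IsStarProjection p₂ ∧ star v * v = p₁ ∧ v * star v = α p₂) ∧
      (∀ a ∈ F, ‖p₁ * a - a * p₁‖ < ε ∧ ‖p₂ * a - a * p₂‖ < ε) ∧
      (∀ a ∈ F, ‖v * p₁ * a * p₁ * star v - α (p₂ * a * p₂)‖ < ε) ∧
      (MvNEquivInHereditary (1 - p₁) x ∧ MvNEquivInHereditary (1 - p₂) x) ∧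
      (1 - ε < ‖p₁ * x * p₁‖ ∧ 1 - ε < ‖p₂ * x * p₂‖)

/-- An element `η` of a (pre)ordered abelian group with order unit `u` is infinitesimal if
`-m u ≤ n η ≤ m u` for all natural numbers `m`, `n` with `m > 0`. -/
def IsInfinitesimal {G : Type*} [AddCommGroup G] [Preorder G] (u η : G) : Prop :=
  ∀ m n : ℕ, 0 < m → -(m • u) ≤ n • η ∧ n • η ≤ m • u

section MatEquiv

open Matrix

variable {A : Type*} [CStarAlgebra A] {l m n l' m' n' : Type*} [Fintype l] [Fintype m] [Fintype n]
  [Fintype l'] [Fintype m'] [Fintype n']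

/-- Murray-von Neumann equivalence of projections in matrix algebras of possibly different sizes,
through rectangular partial isometries. -/
def MatEquiv (P : Matrix m m A) (Q : Matrix n n A) : Prop :=
  ∃ v : Matrix n m A, vᴴ * v = P ∧ v * vᴴ = Q

theorem MatEquiv.symm {P : Matrix m m A} {Q : Matrix n n A} (h : MatEquiv P Q) : MatEquiv Q P := by
  obtain ⟨v, h₁, h₂⟩ := h
  exact ⟨vᴴ, by rw [conjTranspose_conjTranspose, h₂], by rw [conjTranspose_conjTranspose, h₁]⟩

theorem MatEquiv.trans {P : Matrix l l A} {Q : Matrix m m A} {R : Matrix n n A}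
    (hP : IsStarProjection P) (hR : IsStarProjection R)
    (h : MatEquiv P Q) (h' : MatEquiv Q R) : MatEquiv P R := by
  obtain ⟨v, h₁, h₂⟩ := h
  obtain ⟨w, h₃, h₄⟩ := h'
  refine ⟨w * v, ?_, ?_⟩
  · calc (w * v)ᴴ * (w * v) = vᴴ * (wᴴ * w) * v := by
          simp only [conjTranspose_mul, Matrix.mul_assoc]
      _ = (vᴴ * v) * (vᴴ * v) := by rw [h₃, ← h₂]; simp only [Matrix.mul_assoc]
      _ = P := by rw [h₁]; exact hP.isIdempotentElem
  · calc (w * v) * (w * v)ᴴ = w * (v * vᴴ) * wᴴ := by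
          simp only [conjTranspose_mul, Matrix.mul_assoc]
      _ = (w * wᴴ) * (w * wᴴ) := by rw [h₂, ← h₃]; simp only [Matrix.mul_assoc]
      _ = R := by rw [h₄]; exact hR.isIdempotentElem

theorem MatEquiv.submatrix {P : Matrix m m A} (hP : IsStarProjection P) (e : n ≃ m) :
    MatEquiv P (P.submatrix e e) := by
  have h₁ : Pᴴ = P := hP.isSelfAdjoint
  have h₂ : P * P = P := hP.isIdempotentElem
  refine ⟨P.submatrix e id, ?_, ?_⟩
  · rw [conjTranspose_submatrix, h₁, submatrix_mul_equiv, h₂, submatrix_id_id]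
  · rw [conjTranspose_submatrix, h₁, ← submatrix_mul _ _ _ _ _ Function.bijective_id, h₂]

theorem MatEquiv.fromBlocks {P : Matrix m m A} {P' : Matrix m' m' A} {Q : Matrix n n A}
    {Q' : Matrix n' n' A} (hP : MatEquiv P P') (hQ : MatEquiv Q Q') :
    MatEquiv (Matrix.fromBlocks P 0 0 Q) (Matrix.fromBlocks P' 0 0 Q') := by
  obtain ⟨v, h₁, h₂⟩ := hP
  obtain ⟨w, h₃, h₄⟩ := hQ
  refine ⟨Matrix.fromBlocks v 0 0 w, ?_, ?_⟩
  · simp [fromBlocks_conjTranspose, fromBlocks_multiply, h₁, h₃]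
  · simp [fromBlocks_conjTranspose, fromBlocks_multiply, h₂, h₄]

theorem isStarProjection_fromBlocks {P : Matrix m m A} {Q : Matrix n n A}
    (hP : IsStarProjection P) (hQ : IsStarProjection Q) :
    IsStarProjection (Matrix.fromBlocks P 0 0 Q) := by
  have h₁ : Pᴴ = P := hP.isSelfAdjoint
  have h₂ : P * P = P := hP.isIdempotentElem
  have h₃ : Qᴴ = Q := hQ.isSelfAdjoint
  have h₄ : Q * Q = Q := hQ.isIdempotentElem
  refine ⟨?_, ?_⟩
  · change _ * _ = _
    simp [fromBlocks_multiply, h₂, h₄]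
  · change (_)ᴴ = _
    simp [fromBlocks_conjTranspose, h₁, h₃]

theorem isStarProjection_submatrix {P : Matrix m m A} (hP : IsStarProjection P) (e : n ≃ m) :
    IsStarProjection (P.submatrix e e) := by
  have h₁ : Pᴴ = P := hP.isSelfAdjoint
  have h₂ : P * P = P := hP.isIdempotentElem
  refine ⟨?_, ?_⟩
  · change _ * _ = _
    rw [submatrix_mul_equiv, h₂]
  · change (_)ᴴ = _
    rw [conjTranspose_submatrix, h₁]

end MatEquiv

/-- A projection in a matrix algebra `M_n(A)`, for some `n`. -/
structure MatProj (A : Type*) [CStarAlgebra A] where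
  size : ℕ
  mat : Matrix (Fin size) (Fin size) A
  isProj : IsStarProjection mat

namespace MatProj

open Matrix

variable {A B : Type*} [CStarAlgebra A] [CStarAlgebra B]

theorem matEquiv_equivalence : Equivalence fun p q : MatProj A => MatEquiv p.mat q.mat where
  refl p := MatEquiv.submatrix p.isProj (Equiv.refl _)
  symm h := h.symm
  trans {p _ r} h h' := MatEquiv.trans p.isProj r.isProj h h'

instance instSetoid (A : Type*) [CStarAlgebra A] : Setoid (MatProj A) :=
  ⟨fun p q => MatEquiv p.mat q.mat, matEquiv_equivalence⟩

/-- The (unique) projection in `M_0(A)`. -/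
def zero (A : Type*) [CStarAlgebra A] : MatProj A := ⟨0, 0, IsStarProjection.zero _⟩

/-- The projection `1_A`, viewed in `M_1(A)`. -/
def one (A : Type*) [CStarAlgebra A] : MatProj A := ⟨1, 1, IsStarProjection.one _⟩

/-- The block diagonal sum `p ⊕ q`. -/
def directSum (p q : MatProj A) : MatProj A where
  size := p.size + q.size
  mat := (fromBlocks p.mat 0 0 q.mat).submatrix finSumFinEquiv.symm finSumFinEquiv.symm
  isProj := isStarProjection_submatrix (isStarProjection_fromBlocks p.isProj q.isProj) _

/-- A *-homomorphism applied entrywise to a projection. -/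
def map (f : A →⋆ₐ[ℂ] B) (p : MatProj A) : MatProj B where
  size := p.size
  mat := p.mat.map f
  isProj := by
    refine ⟨?_, ?_⟩
    · change _ * _ = _
      rw [← Matrix.map_mul]
      exact congrArg (fun M => M.map f) p.isProj.isIdempotentElem
    · change (_)ᴴ = _
      rw [← conjTranspose_map f (fun a => map_star f a)]
      exact congrArg (fun M => M.map f) p.isProj.isSelfAdjoint

theorem directSum_matEquiv (p q : MatProj A) :
    MatEquiv (fromBlocks p.mat 0 0 q.mat) (directSum p q).mat :=
  MatEquiv.submatrix (isStarProjection_fromBlocks p.isProj q.isProj) finSumFinEquiv.symm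

theorem directSum_equiv_of {p q r : MatProj A}
    (h : MatEquiv (fromBlocks p.mat 0 0 q.mat) r.mat) : directSum p q ≈ r :=
  MatEquiv.trans (directSum p q).isProj r.isProj (directSum_matEquiv p q).symm h

theorem directSum_congr {p p' q q' : MatProj A} (hp : p ≈ p') (hq : q ≈ q') :
    directSum p q ≈ directSum p' q' :=
  directSum_equiv_of (MatEquiv.trans (isStarProjection_fromBlocks p.isProj q.isProj)
    (directSum p' q').isProj (MatEquiv.fromBlocks hp hq) (directSum_matEquiv p' q'))

theorem directSum_comm (p q : MatProj A) : directSum p q ≈ directSum q p := by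
  refine directSum_equiv_of (MatEquiv.trans (isStarProjection_fromBlocks p.isProj q.isProj)
    (directSum q p).isProj ?_ (directSum_matEquiv q p))
  have h := MatEquiv.submatrix (isStarProjection_fromBlocks p.isProj q.isProj)
    (Equiv.sumComm (Fin q.size) (Fin p.size))
  simpa using h

theorem zero_directSum (p : MatProj A) : directSum (zero A) p ≈ p := by
  refine directSum_equiv_of ?_
  have h := MatEquiv.submatrix (isStarProjection_fromBlocks (zero A).isProj p.isProj)
    (Equiv.emptySum (Fin 0) (Fin p.size)).symm
  exact h

theorem directSum_assoc (p q r : MatProj A) :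
    directSum (directSum p q) r ≈ directSum p (directSum q r) := by
  have hpq := isStarProjection_fromBlocks p.isProj q.isProj
  have hqr := isStarProjection_fromBlocks q.isProj r.isProj
  have hl := isStarProjection_fromBlocks (directSum p q).isProj r.isProj
  have hr := isStarProjection_fromBlocks p.isProj (directSum q r).isProj
  refine directSum_equiv_of (MatEquiv.trans hl (directSum p (directSum q r)).isProj ?_
    (directSum_matEquiv p (directSum q r)))
  refine MatEquiv.trans hl hr (MatEquiv.fromBlocks (directSum_matEquiv p q).symm
    (Setoid.refl r : MatEquiv r.mat r.mat)) ?_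
  refine MatEquiv.trans (isStarProjection_fromBlocks hpq r.isProj) hr ?_
    (MatEquiv.fromBlocks (Setoid.refl p : MatEquiv p.mat p.mat) (directSum_matEquiv q r))
  have h := MatEquiv.submatrix (isStarProjection_fromBlocks hpq r.isProj)
    (Equiv.sumAssoc (Fin p.size) (Fin q.size) (Fin r.size)).symm
  convert h using 1
  ext i j
  rcases i with i | i | i <;> rcases j with j | j | j <;> rfl

theorem map_congr (f : A →⋆ₐ[ℂ] B) {p q : MatProj A} (h : p ≈ q) : map f p ≈ map f q := by
  obtain ⟨v, h₁, h₂⟩ := h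
  refine (⟨v.map f, ?_, ?_⟩ : MatEquiv (p.mat.map f) (q.mat.map f))
  · rw [← conjTranspose_map f (fun a => map_star f a), ← Matrix.map_mul, h₁]
  · rw [← conjTranspose_map f (fun a => map_star f a), ← Matrix.map_mul, h₂]

theorem map_directSum (f : A →⋆ₐ[ℂ] B) (p q : MatProj A) :
    map f (directSum p q) = directSum (map f p) (map f q) := by
  have h : (fromBlocks p.mat 0 0 q.mat).map f = fromBlocks (p.mat.map f) 0 0 (q.mat.map f) := by
    ext i j
    rcases i with i | i <;> rcases j with j | j <;> simp
  simp only [directSum, map]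
  congr 1
  exact congrArg (fun M => M.submatrix finSumFinEquiv.symm finSumFinEquiv.symm) h

theorem map_zero (f : A →⋆ₐ[ℂ] B) : map f (zero A) = zero B := by
  simp [zero, map]

end MatProj

/-- The Murray-von Neumann semigroup `V(A)`. -/
def VSemigroup (A : Type*) [CStarAlgebra A] : Type _ := Quotient (MatProj.instSetoid A)

namespace VSemigroup

variable {A B : Type*} [CStarAlgebra A] [CStarAlgebra B]

/-- The class of a projection in `V(A)`. -/
def mk (p : MatProj A) : VSemigroup A := Quotient.mk (MatProj.instSetoid A) p

instance instAdd : Add (VSemigroup A) :=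
  ⟨Quotient.map₂ MatProj.directSum fun _ _ hp _ _ hq => MatProj.directSum_congr hp hq⟩

instance instZero : Zero (VSemigroup A) := ⟨mk (MatProj.zero A)⟩

theorem zero_add_aux (x : VSemigroup A) : 0 + x = x :=
  Quotient.inductionOn x fun p => Quotient.sound (MatProj.zero_directSum p)

theorem add_comm_aux (x y : VSemigroup A) : x + y = y + x :=
  Quotient.inductionOn₂ x y fun p q => Quotient.sound (MatProj.directSum_comm p q)

theorem add_assoc_aux (x y z : VSemigroup A) : x + y + z = x + (y + z) :=
  Quotient.inductionOn₃ x y z fun p q r => Quotient.sound (MatProj.directSum_assoc p q r)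

instance instAddCommMonoid : AddCommMonoid (VSemigroup A) where
  add_assoc := add_assoc_aux
  zero_add := zero_add_aux
  add_zero x := by rw [add_comm_aux, zero_add_aux]
  add_comm := add_comm_aux
  nsmul := nsmulRec

/-- The homomorphism `V(A) → V(B)` induced by a *-homomorphism. -/
def map (f : A →⋆ₐ[ℂ] B) : VSemigroup A →+ VSemigroup B where
  toFun := Quotient.map (MatProj.map f) fun _ _ h => MatProj.map_congr f h
  map_zero' := congrArg mk (MatProj.map_zero f)
  map_add' x y := Quotient.inductionOn₂ x y fun p q => congrArg mk (MatProj.map_directSum f p q)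

end VSemigroup

/-- `K_0(A)` of a unital C*-algebra: the Grothendieck group of `V(A)`. -/
def K0 (A : Type*) [CStarAlgebra A] : Type _ := Algebra.GrothendieckAddGroup (VSemigroup A)

namespace K0

variable {A B : Type*} [CStarAlgebra A] [CStarAlgebra B]

instance instAddCommGroup : AddCommGroup (K0 A) :=
  inferInstanceAs (AddCommGroup (Algebra.GrothendieckAddGroup (VSemigroup A)))

/-- The canonical homomorphism `V(A) → K_0(A)`. -/
def ofV : VSemigroup A →+ K0 A := Algebra.GrothendieckAddGroup.of

/-- The class `[p]` in `K_0(A)` of a projection in a matrix algebra over `A`. -/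
def cls (p : MatProj A) : K0 A := ofV (VSemigroup.mk p)

/-- The class `[1_A]`. -/
def unitClass (A : Type*) [CStarAlgebra A] : K0 A := cls (MatProj.one A)

/-- The order on `K_0(A)` whose positive cone is the set of all classes of projections in matrix
algebras over `A`. It need not be antisymmetric if `A` is not stably finite. -/
instance instPreorder : Preorder (K0 A) where
  le x y := ∃ p : MatProj A, y - x = cls p
  le_refl x := ⟨MatProj.zero A, by rw [sub_self]; exact (map_zero ofV).symm⟩
  le_trans := by
    rintro x y z ⟨p, hp⟩ ⟨q, hq⟩
    refine ⟨MatProj.directSum p q, ?_⟩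
    rw [← sub_add_sub_cancel' y x z, hp, hq]
    exact (map_add ofV _ _).symm

/-- The homomorphism `K_0(A) → K_0(B)` induced by a *-homomorphism. -/
noncomputable def map (f : A →⋆ₐ[ℂ] B) : K0 A →+ K0 B :=
  Algebra.GrothendieckAddGroup.lift (ofV.comp (VSemigroup.map f))

end K0

/-! Write η = [e] - [f] with e, f projections over A. If p₁, p₂, v witness tracial approximate
innerness closely enough on the entries of e, a projection of size k, then v carries p₁ e p₁ nearly
onto α(p₂ e p₂), and what lies outside these corners is controlled by k copies of 1 - p₁. Hence
±([α(e)] - [e]) ≤ k [1 - p₁] in K₀ (`K0.exists_map_cls_sub_cls_le`); the same holds for f.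

It remains to make 1 - p₁ small: for every N, the element x can be chosen so that N [q] ≤ [1] for
each projection q in the hereditary subalgebra of x (`IsSimpleCStar.exists_small`). An
infinite-dimensional C*-algebra contains N nonzero pairwise orthogonal positive elements aᵢ, and by
simplicity some nonzero y factors through every aᵢ. With x a multiple of y* y, such a q also factors
through each aᵢ, which gives N copies of q with orthogonal ranges. Taking N = n (size e + size f)
bounds n (α_*(η) - η) on both sides by [1], hence by m [1]. -/

/-! ### Inverse square roots and rescaling to partial isometries. -/

/-- A self-adjoint element with strictly positive spectrum has an inverse square root. -/
theorem exists_selfAdjoint_conj_eq_one {B : Type*} [CStarAlgebra B] {T : B}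
    (hT : IsSelfAdjoint T) (hpos : ∀ x ∈ spectrum ℝ T, 0 < x) :
    ∃ g : B, IsSelfAdjoint g ∧ g * T * g = 1 ∧ ∀ e, Commute T e → Commute g e := by
  have hc : ContinuousOn (fun x : ℝ => (√x)⁻¹) (spectrum ℝ T) :=
    ContinuousOn.inv₀ Real.continuous_sqrt.continuousOn
      fun x hx => (Real.sqrt_pos.mpr (hpos x hx)).ne'
  refine ⟨cfc (fun x : ℝ => (√x)⁻¹) T, cfc_predicate _ T, ?_, fun e he => he.cfc_real _⟩
  conv_lhs => enter [1, 2]; rw [← cfc_id' ℝ T]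
  rw [← cfc_mul _ (fun x => x) T hc continuousOn_id,
    ← cfc_mul (fun x => (√x)⁻¹ * x) _ T (hc.mul continuousOn_id) hc,
    ← cfc_one ℝ T]
  refine cfc_congr fun x hx => ?_
  have h := hpos x hx
  have h' := (Real.sqrt_pos.mpr h).ne'
  simp only [Pi.one_apply]
  field_simp
  exact (Real.sq_sqrt h.le).symm

theorem spectrum_pos_of_norm_sub_one_lt_one {B : Type*} [CStarAlgebra B] {T : B}
    (h : ‖T - 1‖ < 1) : ∀ x ∈ spectrum ℝ T, 0 < x := by
  intro x hx
  cases subsingleton_or_nontrivial B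
  · simp [spectrum.of_subsingleton] at hx
  have h1 : x - 1 ∈ spectrum ℝ (T - 1) := by
    simpa [sub_eq_add_neg, add_comm] using (spectrum.add_mem_add_iff (s := (-1 : ℝ))).mpr hx
  have h2 := spectrum.norm_le_norm_of_mem h1
  rw [Real.norm_eq_abs] at h2
  linarith [neg_abs_le (x - 1)]

/-- If `u q = u` is bounded below on the projection `q`, it can be rescaled to a partial isometry
with initial projection `q`. -/
theorem exists_star_mul_self_eq_of_mul_eq {A : Type*} [CStarAlgebra A] {q u Y : A}
    (hq : IsStarProjection q) (hu : u * q = u) (hY : Y * u = q) :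
    ∃ g : A, star (u * g) * (u * g) = q := by
  let _ := CStarAlgebra.spectralOrder A
  have _ := CStarAlgebra.spectralOrderedRing A
  have hqq : q * q = q := hq.isIdempotentElem
  have hqs : star q = q := hq.isSelfAdjoint
  have hqu : q * star u = star u := by
    simpa [hqs] using congrArg star hu
  -- K must dominate both ‖Y‖², for q ≤ K u*u, and 1, for 1 - q ≤ K (1 - q); together these give 1 ≤
  -- K T.
  set K : ℝ := 1 + ‖Y‖ ^ 2
  have hK : 0 < K := by positivity
  -- Adding 1 - q makes u*u invertible in A and leaves the corner of q unchanged, so T^(-1/2)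
  -- commutes with q and rescales u.
  set T : A := star u * u + (1 - q)
  have hq1 : (0 : A) ≤ 1 - q := hq.one_sub.nonneg
  have huu : 0 ≤ star u * u := star_mul_self_nonneg u
  have h1 : q ≤ ‖Y‖ ^ 2 • (star u * u) := by
    have hy : star Y * Y ≤ algebraMap ℝ A (‖Y‖ ^ 2) := by
      have := CStarAlgebra.star_mul_le_algebraMap_norm_sq (a := Y)
      simpa using this
    have := star_left_conjugate_le_conjugate hy u
    calc q = star (Y * u) * (Y * u) := by rw [hY, hqs, hqq]
      _ = star u * (star Y * Y) * u := by simp only [star_mul, mul_assoc]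
      _ ≤ _ := this
      _ = _ := by rw [Algebra.algebraMap_eq_smul_one]; simp
  have h2 : algebraMap ℝ A K⁻¹ ≤ T := by
    have h3 : (1 : A) ≤ K • T := by
      calc (1 : A) = q + (1 - q) := by abel
        _ ≤ K • (star u * u) + K • (1 - q) := by
            gcongr ?_ + ?_
            · refine h1.trans ?_
              gcongr
              simp [K]
            · have hK1 : (1 : ℝ) ≤ K := by simp [K]
              simpa using smul_le_smul_of_nonneg_right hK1 hq1
        _ = K • T := (smul_add ..).symm
    have := smul_le_smul_of_nonneg_left h3 (inv_nonneg.mpr hK.le)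
    rwa [smul_smul, inv_mul_cancel₀ hK.ne', one_smul, ← Algebra.algebraMap_eq_smul_one] at this
  have hT : IsSelfAdjoint T := (huu.isSelfAdjoint).add hq1.isSelfAdjoint
  rw [algebraMap_le_iff_le_spectrum (a := T)] at h2
  obtain ⟨g, hg, hgT, hcomm⟩ := exists_selfAdjoint_conj_eq_one hT
    fun x hx => (inv_pos.mpr hK).trans_le (h2 x hx)
  have hTq : T * q = star u * u := by simp [T, add_mul, sub_mul, mul_assoc, hu, hqq]
  have hqT : q * T = star u * u := by simp [T, mul_add, mul_sub, ← mul_assoc, hqu, hqq]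
  have hgq : g * q = q * g := hcomm q (hTq.trans hqT.symm)
  refine ⟨g, ?_⟩
  calc star (u * g) * (u * g) = g * (star u * u) * g := by
        rw [star_mul, hg.star_eq]; simp only [mul_assoc]
    _ = g * T * g * q := by rw [← hTq, mul_assoc (g * T), hgq]; simp only [mul_assoc]
    _ = q := by rw [hgT, one_mul]

/-! ### Orthogonal positive elements in infinite-dimensional C*-algebras. -/

section Orthogonal

variable {A : Type*} [CStarAlgebra A] [PartialOrder A] [StarOrderedRing A]

/-- A family of nonzero positive elements, pairwise orthogonal. -/
structure IsPosOrthogonal {ι : Type*} (a : ι → A) : Prop where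
  nonneg : ∀ i, 0 ≤ a i
  ne_zero : ∀ i, a i ≠ 0
  mul_eq_zero : ∀ i j, i ≠ j → a i * a j = 0

theorem mul_eq_zero_swap_of_nonneg {b c : A} (hb : 0 ≤ b) (hc : 0 ≤ c) (h : b * c = 0) :
    c * b = 0 := by
  simpa [hb.isSelfAdjoint.star_eq, hc.isSelfAdjoint.star_eq] using congrArg star h

theorem IsPosOrthogonal.cons {N : ℕ} {a : Fin N → A} (ha : IsPosOrthogonal a) {b : A}
    (hb : 0 ≤ b) (hb0 : b ≠ 0) (h : ∀ j, b * a j = 0) :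
    IsPosOrthogonal (Fin.cons b a : Fin (N + 1) → A) := by
  refine ⟨fun i => ?_, fun i => ?_, fun i j hij => ?_⟩
  · induction i using Fin.cases with
    | zero => simpa
    | succ i => simpa using ha.nonneg i
  · induction i using Fin.cases with
    | zero => simpa
    | succ i => simpa using ha.ne_zero i
  · induction i using Fin.cases with
    | zero =>
      induction j using Fin.cases with
      | zero => exact absurd rfl hij
      | succ j => simpa using h j
    | succ i =>
      induction j using Fin.cases with
      | zero => simpa using mul_eq_zero_swap_of_nonneg hb (ha.nonneg i) (h i)
      | succ j => simpa using ha.mul_eq_zero i j (by simpa using hij)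

theorem IsPosOrthogonal.update {N : ℕ} {a : Fin N → A} (ha : IsPosOrthogonal a) {c : A}
    (hc : 0 ≤ c) (hc0 : c ≠ 0) (i : Fin N) (h : ∀ j, j ≠ i → c * a j = 0) :
    IsPosOrthogonal (Function.update a i c) := by
  refine ⟨fun j => ?_, fun j => ?_, fun j k hjk => ?_⟩
  · by_cases hj : j = i
    · subst hj; simpa
    · simpa [hj] using ha.nonneg j
  · by_cases hj : j = i
    · subst hj; simpa
    · simpa [hj] using ha.ne_zero j
  · by_cases hj : j = i
    · subst hj
      simpa [hjk.symm] using h k hjk.symm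
    · by_cases hk : k = i
      · subst hk
        simpa [hj] using mul_eq_zero_swap_of_nonneg hc (ha.nonneg j) (h j hj)
      · simpa [hj, hk] using ha.mul_eq_zero j k hjk

/-- An orthogonal family of nonzero positive elements that is as long as possible. -/
structure IsMaxPosOrthogonal {N : ℕ} (a : Fin N → A) : Prop extends IsPosOrthogonal a where
  not_longer : ∀ b : Fin (N + 1) → A, ¬ IsPosOrthogonal b

namespace IsMaxPosOrthogonal

variable {N : ℕ} {a : Fin N → A}

theorem eq_zero_of_orthogonal (ha : IsMaxPosOrthogonal a) {b : A} (hb : 0 ≤ b)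
    (h : ∀ j, b * a j = 0) : b = 0 := by
  by_contra hb0
  exact ha.not_longer _ (ha.toIsPosOrthogonal.cons hb hb0 h)

/-- Otherwise aᵢ could be replaced by the two elements b and c, lengthening the family. -/
theorem eq_zero_or_eq_zero (ha : IsMaxPosOrthogonal a) (i : Fin N) {b c : A} (hb : 0 ≤ b)
    (hc : 0 ≤ c) (hbc : b * c = 0) (hbi : ∀ j, j ≠ i → b * a j = 0)
    (hci : ∀ j, j ≠ i → c * a j = 0) : b = 0 ∨ c = 0 := by
  by_contra! h
  refine ha.not_longer _ ((ha.toIsPosOrthogonal.update hc h.2 i hci).cons hb h.1 fun j => ?_)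
  by_cases hj : j = i
  · subst hj; simpa
  · simpa [hj] using hbi j hj

/-- The positive and negative parts of b are orthogonal to each other and to every aⱼ with j ≠ i, so
one of them vanishes. -/
theorem nonneg_or_nonpos (ha : IsMaxPosOrthogonal a) (i : Fin N) {b : A} (hb : IsSelfAdjoint b)
    (hbi : ∀ j, j ≠ i → b * a j = 0) : 0 ≤ b ∨ b ≤ 0 := by
  -- Here (c y)* (c y) = y* c² y = y* d b y = 0; applied to c = b⁺ and c = b⁻.
  have key : ∀ c d y : A, 0 ≤ c → c * c = d * b → b * y = 0 → c * y = 0 := by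
    intro c d y hc hcc hy
    rw [← CStarRing.star_mul_self_eq_zero_iff, star_mul, hc.isSelfAdjoint.star_eq, mul_assoc,
      ← mul_assoc c c y, hcc, mul_assoc d b y, hy, mul_zero, mul_zero]
  have hsub := CFC.posPart_sub_negPart b hb
  have h1 := CFC.posPart_mul_negPart b
  have h2 := CFC.negPart_mul_posPart b
  have hp : b⁺ * b⁺ = b⁺ * b := by
    have h := mul_sub b⁺ b⁺ b⁻
    rw [hsub, h1, sub_zero] at h
    exact h.symm
  have hn : b⁻ * b⁻ = -b⁻ * b := by
    have h := mul_sub b⁻ b⁺ b⁻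
    rw [hsub, h2, zero_sub] at h
    rw [neg_mul, h, neg_neg]
  rcases ha.eq_zero_or_eq_zero i (CFC.posPart_nonneg b) (CFC.negPart_nonneg b) h1
    (fun j hj => key _ _ _ (CFC.posPart_nonneg b) hp (hbi j hj))
    (fun j hj => key _ _ _ (CFC.negPart_nonneg b) hn (hbi j hj)) with h | h
  · right
    rw [← hsub, h, zero_sub]
    exact neg_nonpos.mpr (CFC.negPart_nonneg b)
  · left
    rw [← hsub, h, sub_zero]
    exact CFC.posPart_nonneg b

/-- Every b + s aᵢ has a definite sign, and both signs occur as s varies; by connectedness of ℝ some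
s gives both signs at once, that is, zero. -/
theorem exists_eq_smul (ha : IsMaxPosOrthogonal a) (i : Fin N) {b : A} (hb : IsSelfAdjoint b)
    (hbi : ∀ j, j ≠ i → b * a j = 0) : ∃ s : ℝ, b = s • a i := by
  have hpos : ∀ {c : A}, IsSelfAdjoint c → (∀ j, j ≠ i → c * a j = 0) →
      ∃ s : ℝ, 0 ≤ c + s • a i := by
    intro c hc hci
    -- If c + s aᵢ is never positive, it is always negative; dividing by s and letting s → ∞ gives
    -- aᵢ ≤ 0.
    by_contra! hneg
    have hlim : Filter.Tendsto (fun s : ℝ => s⁻¹ • c + a i) Filter.atTop (nhds (a i)) := by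
      simpa using ((tendsto_inv_atTop_zero (𝕜 := ℝ)).smul_const c).add_const (a i)
    have hle : a i ≤ 0 := by
      refine le_of_tendsto hlim ?_
      filter_upwards [Filter.eventually_gt_atTop 0] with s hs
      have hsa : IsSelfAdjoint (c + s • a i) :=
        hc.add (IsSelfAdjoint.smul (IsSelfAdjoint.all s) (ha.nonneg i).isSelfAdjoint)
      have h := (ha.nonneg_or_nonpos i hsa fun j hj => by
        rw [add_mul, hci j hj, smul_mul_assoc, ha.mul_eq_zero i j hj.symm, smul_zero,
          add_zero]).resolve_left (hneg s)
      have h' := smul_le_smul_of_nonneg_left h (inv_nonneg.mpr hs.le)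
      rwa [smul_add, smul_smul, inv_mul_cancel₀ hs.ne', one_smul, smul_zero] at h'
    exact ha.ne_zero i (le_antisymm hle (ha.nonneg i))
  have hcont : Continuous fun s : ℝ => b + s • a i := by fun_prop
  obtain ⟨s₁, hs₁⟩ := hpos hb hbi
  obtain ⟨s₂, hs₂⟩ := hpos hb.neg fun j hj => by rw [neg_mul, hbi j hj, neg_zero]
  have huniv : (Set.univ : Set ℝ) ⊆ {s | 0 ≤ b + s • a i} ∪ {s | b + s • a i ≤ 0} := by
    intro s _
    refine ha.nonneg_or_nonpos i
      (hb.add (IsSelfAdjoint.smul (IsSelfAdjoint.all s) (ha.nonneg i).isSelfAdjoint)) fun j hj => ?_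
    rw [add_mul, hbi j hj, smul_mul_assoc, ha.mul_eq_zero i j hj.symm, smul_zero, add_zero]
  obtain ⟨s, -, hs, hs'⟩ := isPreconnected_closed_iff.mp isPreconnected_univ _ _
    (isClosed_le continuous_const hcont) (isClosed_le hcont continuous_const) huniv
    ⟨s₁, trivial, hs₁⟩ ⟨-s₂, trivial, by
      change b + -s₂ • a i ≤ 0
      have := neg_nonpos.mpr hs₂
      rwa [neg_add, neg_neg, ← neg_smul] at this⟩
  refine ⟨-s, ?_⟩
  rw [neg_smul, eq_neg_iff_add_eq_zero]
  exact le_antisymm hs' hs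

theorem exists_smul_isStarProjection (ha : IsMaxPosOrthogonal a) (i : Fin N) :
    ∃ t : ℝ, t ≠ 0 ∧ IsStarProjection (t • a i) := by
  have hsa := (ha.nonneg i).isSelfAdjoint
  obtain ⟨s, hs⟩ := ha.exists_eq_smul i (b := a i * a i)
    (by rw [isSelfAdjoint_iff, star_mul, hsa.star_eq])
    fun j hj => by rw [mul_assoc, ha.mul_eq_zero i j hj.symm, mul_zero]
  have hs0 : s ≠ 0 := by
    rintro rfl
    refine ha.ne_zero i ((CStarRing.star_mul_self_eq_zero_iff _).mp ?_)
    rw [hsa.star_eq, hs, zero_smul]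
  refine ⟨s⁻¹, inv_ne_zero hs0, ?_, IsSelfAdjoint.smul (IsSelfAdjoint.all _) hsa⟩
  change s⁻¹ • a i * s⁻¹ • a i = s⁻¹ • a i
  rw [smul_mul_smul_comm, hs, smul_smul, mul_assoc, inv_mul_cancel₀ hs0, mul_one]

/-- Rescaling the aᵢ gives orthogonal projections pᵢ with sum 1 and pᵢ A pᵢ = ℂ pᵢ. Each pᵢ A pⱼ is
then at most a line, and A is the sum of these finitely many pieces. -/
theorem finiteDimensional (ha : IsMaxPosOrthogonal a) : FiniteDimensional ℂ A := by
  choose t ht hp using ha.exists_smul_isStarProjection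
  set p : Fin N → A := fun i => t i • a i with hpdef
  have hpp : ∀ i, p i * p i = p i := fun i => (hp i).isIdempotentElem
  have hps : ∀ i, star (p i) = p i := fun i => (hp i).isSelfAdjoint
  have hpa : ∀ i j, i ≠ j → p i * a j = 0 := fun i j hij => by
    simp [hpdef, ha.mul_eq_zero i j hij]
  have hpij : ∀ i j, i ≠ j → p i * p j = 0 := fun i j hij => by
    rw [hpdef]; simp [ha.mul_eq_zero i j hij]
  have hpai : ∀ i, p i * a i = a i := fun i => by
    have h : a i = (t i)⁻¹ • p i := by simp [hpdef, smul_smul, ht i]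
    rw [h, mul_smul_comm, hpp]
  have hsum : ∑ i, p i = 1 := by
    have hS : IsStarProjection (∑ i, p i) := by
      constructor
      · change _ * _ = _
        rw [Finset.sum_mul]
        refine Finset.sum_congr rfl fun i _ => ?_
        rw [Finset.mul_sum, Finset.sum_eq_single i (fun j _ hj => hpij i j hj.symm) (by simp), hpp]
      · rw [isSelfAdjoint_iff, star_sum]
        exact Finset.sum_congr rfl fun i _ => hps i
    refine (sub_eq_zero.mp (ha.eq_zero_of_orthogonal hS.one_sub.nonneg fun j => ?_)).symm
    rw [sub_mul, one_mul, Finset.sum_mul,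
      Finset.sum_eq_single j (fun i _ hi => hpa i j hi) (by simp), hpai, sub_self]
  have hcorner : ∀ i (x : A), ∃ z : ℂ, p i * x * p i = z • p i := by
    have hreal : ∀ i (x : A), IsSelfAdjoint x → ∃ z : ℂ, p i * x * p i = z • p i := by
      intro i x hx
      obtain ⟨s, hs⟩ := ha.exists_eq_smul i (b := p i * x * p i)
        (by rw [isSelfAdjoint_iff, star_mul, star_mul, hps, hx.star_eq, mul_assoc])
        fun j hj => by rw [mul_assoc, hpa i j hj.symm, mul_zero]
      refine ⟨((s * (t i)⁻¹ : ℝ) : ℂ), ?_⟩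
      rw [hs, Complex.coe_smul, hpdef, smul_smul, mul_assoc, inv_mul_cancel₀ (ht i), mul_one]
    intro i x
    obtain ⟨z, hz⟩ := hreal i _ (realPart x).2
    obtain ⟨w, hw⟩ := hreal i _ (imaginaryPart x).2
    refine ⟨z + Complex.I * w, ?_⟩
    conv_lhs => rw [← realPart_add_I_smul_imaginaryPart x]
    rw [mul_add, add_mul, hz, mul_smul_comm Complex.I, smul_mul_assoc Complex.I, hw, smul_smul,
      add_smul]
  have hline : ∀ ij : Fin N × Fin N, ∃ y : A, ∀ x : A, ∃ z : ℂ, p ij.1 * x * p ij.2 = z • y := by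
    rintro ⟨i, j⟩
    by_cases h : ∀ x : A, p i * x * p j = 0
    · exact ⟨0, fun x => ⟨0, by simp [h x]⟩⟩
    · push Not at h
      obtain ⟨x₀, hx₀⟩ := h
      refine ⟨p i * x₀ * p j, fun x => ?_⟩
      obtain ⟨l, hl⟩ := hcorner j (star x₀ * p i * x₀)
      obtain ⟨m, hm⟩ := hcorner i (x * p j * star x₀)
      have hyy : star (p i * x₀ * p j) * (p i * x₀ * p j) = l • p j := by
        rw [← hl]
        simp only [star_mul, hps, mul_assoc]
        rw [← mul_assoc (p i) (p i), hpp]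
      have hl0 : l ≠ 0 := by
        rintro rfl
        rw [zero_smul, CStarRing.star_mul_self_eq_zero_iff] at hyy
        exact hx₀ hyy
      refine ⟨l⁻¹ * m, ?_⟩
      -- Both sides equal pᵢ x pⱼ x₀* pᵢ x₀ pⱼ, read through the corner at j and through the corner
      -- at i.
      have h1 : l • (p i * x * p j) = m • (p i * x₀ * p j) := by
        calc l • (p i * x * p j) = p i * x * p j * (l • p j) := by
              rw [mul_smul_comm l, mul_assoc _ (p j) (p j), hpp]
          _ = p i * (x * p j * star x₀) * p i * (x₀ * p j) := by
              rw [← hl]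
              simp only [mul_assoc]
              rw [← mul_assoc (p j) (p j), hpp]
          _ = _ := by rw [hm, smul_mul_assoc, mul_assoc]
      rw [mul_smul, ← h1, smul_smul, inv_mul_cancel₀ hl0, one_smul]
  choose y hy using hline
  classical
  refine ⟨⟨Finset.univ.image y, ?_⟩⟩
  rw [eq_top_iff]
  intro x _
  have hx : x = ∑ i, ∑ j, p i * x * p j := by
    simp_rw [← Finset.mul_sum, hsum, mul_one, ← Finset.sum_mul, hsum, one_mul]
  rw [hx]
  refine Submodule.sum_mem _ fun i _ => Submodule.sum_mem _ fun j _ => ?_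
  obtain ⟨z, hz⟩ := hy (i, j) x
  rw [hz]
  exact Submodule.smul_mem _ _ (Submodule.subset_span (by simp))

end IsMaxPosOrthogonal

theorem exists_isPosOrthogonal (hinf : ¬ FiniteDimensional ℂ A) (n : ℕ) :
    ∃ a : Fin n → A, IsPosOrthogonal a := by
  induction n with
  | zero => exact ⟨Fin.elim0, fun i => i.elim0, fun i => i.elim0, fun i => i.elim0⟩
  | succ n ih =>
    obtain ⟨a, ha⟩ := ih
    by_contra! h
    exact hinf (IsMaxPosOrthogonal.finiteDimensional ⟨ha, h⟩)

end Orthogonal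

/-! ### Small hereditary subalgebras of simple C*-algebras. -/

section Simple

variable {A : Type*} [CStarAlgebra A]

/-- A simple C*-algebra is prime. -/
theorem IsSimpleCStar.exists_mul_mul_ne_zero (hA : IsSimpleCStar A) {a y : A} (ha : a ≠ 0)
    (hy : y ≠ 0) : ∃ z, a * z * y ≠ 0 := by
  by_contra! h
  -- The closed ideal of all b with a A b = 0 contains y ≠ 0, so it contains 1, forcing a = 0.
  let I : TwoSidedIdeal A := TwoSidedIdeal.mk' {b | ∀ z, a * z * b = 0} (by simp)
    (fun {x y} hx hy z => by rw [mul_add, hx z, hy z, add_zero])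
    (fun {x} hx z => by rw [mul_neg, hx z, neg_zero])
    (fun {x y} hy z => by rw [← mul_assoc, mul_assoc a z x]; exact hy _)
    (fun {x y} hx z => by rw [← mul_assoc, hx z, zero_mul])
  have hmem : ∀ b, b ∈ I ↔ ∀ z, a * z * b = 0 := fun b => by
    simp only [I, TwoSidedIdeal.mem_mk', Set.mem_ofPred_eq]
  have hclosed : IsClosed (I : Set A) := by
    have : (I : Set A) = ⋂ z, {b | a * z * b = 0} := by
      ext b
      simp [hmem]
    rw [this]
    exact isClosed_iInter fun z => isClosed_eq (by fun_prop) continuous_const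
  rcases hA.2 I hclosed with h0 | h1
  · have : y ∈ I := (hmem y).mpr h
    rw [h0, TwoSidedIdeal.mem_bot] at this
    exact hy this
  · have : (1 : A) ∈ I := by rw [h1]; trivial
    exact ha (by simpa using (hmem 1).mp this 1)

/-- Induction by primeness: if y factors through the later elements, some a₀ x y ≠ 0 factors through
these and through a₀. -/
theorem IsSimpleCStar.exists_common_left_multiple (hA : IsSimpleCStar A) {n : ℕ} (a : Fin n → A)
    (ha : ∀ i, a i ≠ 0) :
    ∃ (y : A) (z w : Fin n → A), y ≠ 0 ∧ ∀ i, y = w i * (a i * z i) := by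
  induction n with
  | zero =>
    have := hA.1
    exact ⟨1, Fin.elim0, Fin.elim0, one_ne_zero, fun i => i.elim0⟩
  | succ n ih =>
    obtain ⟨y, z, w, hy, h⟩ := ih (fun i => a i.succ) fun i => ha _
    obtain ⟨x, hx⟩ := hA.exists_mul_mul_ne_zero (ha 0) hy
    refine ⟨a 0 * x * y, Fin.cons (x * y) z, Fin.cons 1 fun i => a 0 * x * w i, hx, fun i => ?_⟩
    induction i using Fin.cases with
    | zero => simp [mul_assoc]
    | succ i => simp [mul_assoc, ← h i]

/-- An infinite-dimensional simple unital C*-algebra contains positive elements that are small: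
every projection in the hereditary subalgebra has `n` pairwise orthogonal copies. -/
theorem IsSimpleCStar.exists_small [PartialOrder A] [StarOrderedRing A]
    (hA : IsSimpleCStar A) (hinf : ¬ FiniteDimensional ℂ A) (n : ℕ) :
    ∃ x : A, 0 ≤ x ∧ ‖x‖ = 1 ∧ ∀ q, IsStarProjection q → q ∈ hereditaryClosure x →
      ∃ s : Fin n → A, ∀ i j, star (s i) * s j = if i = j then q else 0 := by
  obtain ⟨a, ha⟩ := exists_isPosOrthogonal (A := A) hinf n
  obtain ⟨y, z, w, hy, hyw⟩ := hA.exists_common_left_multiple a ha.ne_zero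
  have hyy : star y * y ≠ 0 := fun h => hy ((CStarRing.star_mul_self_eq_zero_iff y).mp h)
  set r : ℝ := ‖star y * y‖⁻¹
  have hr : 0 ≤ r := by positivity
  set x : A := r • (star y * y)
  have hxw : ∀ i, x = (r • (star y * w i)) * (a i * z i) := fun i => by
    rw [smul_mul_assoc, mul_assoc (star y), ← hyw i]
  refine ⟨x, smul_nonneg hr (star_mul_self_nonneg y), ?_, fun q hq hqx => ?_⟩
  · rw [norm_smul, Real.norm_of_nonneg hr, inv_mul_cancel₀ (norm_ne_zero_iff.mpr hyy)]
  have hqq : q * q = q := hq.isIdempotentElem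
  have hqnorm : ‖q‖ ≤ 1 := hq.norm_le
  obtain ⟨_, ⟨b, rfl⟩, hb⟩ := Metric.mem_closure_iff.mp hqx 1 one_pos
  rw [dist_eq_norm] at hb
  -- d is within 1 of q, hence left invertible relative to q. Since the right-hand x in d factors
  -- through aᵢ zᵢ, the element aᵢ zᵢ b x q has a left inverse relative to q and can be rescaled to
  -- a partial isometry.
  set d : A := q * (x * b * x) * q
  have hd : ‖q - d‖ < 1 := by
    have : q - d = q * (q - x * b * x) * q := by rw [mul_sub, sub_mul, hqq, hqq]
    rw [this]
    calc ‖q * (q - x * b * x) * q‖ ≤ ‖q‖ * ‖q - x * b * x‖ * ‖q‖ :=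
          (norm_mul_le _ _).trans (by gcongr; exact norm_mul_le _ _)
      _ ≤ 1 * ‖q - x * b * x‖ * 1 := by gcongr
      _ < 1 := by simpa using hb
  obtain ⟨v, hv⟩ := (isUnit_one_sub_of_norm_lt_one hd).exists_left_inv
  have hvq : v * d = q := by
    calc v * d = v * (1 - (q - d)) * q := by
          have hdq : d * q = d := by simp only [d, mul_assoc, hqq]
          rw [mul_assoc, sub_mul, sub_mul, hqq, hdq, one_mul, sub_sub_cancel]
      _ = q := by rw [hv, one_mul]
  have hs : ∀ i, ∃ g, star (a i * z i * (b * x * q) * g) * (a i * z i * (b * x * q) * g) = q := by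
    intro i
    refine exists_star_mul_self_eq_of_mul_eq (Y := v * (q * (r • (star y * w i)))) hq
      (by simp only [mul_assoc, hqq]) ?_
    calc v * (q * (r • (star y * w i))) * (a i * z i * (b * x * q))
        = v * (q * ((r • (star y * w i)) * (a i * z i)) * b * x * q) := by
          simp only [mul_assoc]
      _ = v * d := by rw [← hxw i]; simp only [d, mul_assoc]
      _ = q := hvq
  choose g hg using hs
  refine ⟨fun i => a i * z i * (b * x * q) * g i, fun i j => ?_⟩
  split_ifs with hij
  · subst hij
    exact hg i
  · simp only [star_mul, mul_assoc]
    rw [(ha.nonneg i).isSelfAdjoint.star_eq, ← mul_assoc (a i) (a j), ha.mul_eq_zero i j hij]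
    simp

end Simple

/-! ### Classes of projections in K₀ and their order. -/

section ProjectionClasses

open Matrix

variable {A : Type*} [CStarAlgebra A] {m n : Type*} [Fintype m] [Fintype n]

/-- A projection in a matrix algebra indexed by a finite type, as an element of `MatProj`. -/
noncomputable def MatProj.ofFintype (P : Matrix n n A) (hP : IsStarProjection P) : MatProj A :=
  ⟨Fintype.card n, P.submatrix (Fintype.equivFin n).symm (Fintype.equivFin n).symm,
    isStarProjection_submatrix hP _⟩

theorem MatProj.matEquiv_ofFintype (P : Matrix n n A) (hP : IsStarProjection P) :
    MatEquiv P (MatProj.ofFintype P hP).mat :=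
  MatEquiv.submatrix hP _

namespace K0

/-- The class in `K_0(A)` of a projection in a matrix algebra indexed by a finite type. -/
noncomputable def fcls (P : Matrix n n A) (hP : IsStarProjection P) : K0 A :=
  cls (MatProj.ofFintype P hP)

theorem cls_eq_of_matEquiv {p q : MatProj A} (h : MatEquiv p.mat q.mat) : cls p = cls q :=
  congrArg ofV (Quotient.sound h : VSemigroup.mk p = VSemigroup.mk q)

theorem cls_directSum (p q : MatProj A) : cls (MatProj.directSum p q) = cls p + cls q :=
  map_add ofV (VSemigroup.mk p) (VSemigroup.mk q)

theorem map_cls {B : Type*} [CStarAlgebra B] (f : A →⋆ₐ[ℂ] B) (p : MatProj A) :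
    map f (cls p) = cls (MatProj.map f p) := by
  have h := DFunLike.congr_fun
    (Algebra.GrothendieckAddGroup.lift.symm_apply_apply ((ofV (A := B)).comp (VSemigroup.map f)))
    (VSemigroup.mk p)
  exact h

theorem exists_eq_cls_sub_cls (η : K0 A) : ∃ p q : MatProj A, η = cls p - cls q := by
  obtain ⟨⟨x, y, _⟩, h⟩ := (AddLocalization.addMonoidOf (⊤ : AddSubmonoid (VSemigroup A))).surj η
  induction x using Quotient.inductionOn with | _ p
  induction y using Quotient.inductionOn with | _ q
  exact ⟨p, q, eq_sub_of_add_eq h⟩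

instance instIsOrderedAddMonoid : IsOrderedAddMonoid (K0 A) where
  add_le_add_left := by
    rintro a b ⟨p, hp⟩ c
    exact ⟨p, by rw [add_sub_add_right_eq_sub, hp]⟩

theorem cls_nonneg (p : MatProj A) : 0 ≤ cls p := ⟨p, sub_zero _⟩

theorem fcls_eq_cls (p : MatProj A) : fcls p.mat p.isProj = cls p :=
  (cls_eq_of_matEquiv (MatProj.matEquiv_ofFintype p.mat p.isProj)).symm

theorem fcls_nonneg {P : Matrix n n A} (hP : IsStarProjection P) : 0 ≤ fcls P hP := cls_nonneg _

theorem fcls_eq_of_matEquiv {P : Matrix m m A} {Q : Matrix n n A} (hP : IsStarProjection P)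
    (hQ : IsStarProjection Q) (h : MatEquiv P Q) : fcls P hP = fcls Q hQ :=
  cls_eq_of_matEquiv (MatEquiv.trans (MatProj.isProj _) (MatProj.isProj _)
    (MatEquiv.trans (MatProj.isProj _) hQ (MatProj.matEquiv_ofFintype P hP).symm h)
    (MatProj.matEquiv_ofFintype Q hQ))

theorem fcls_fromBlocks {P : Matrix m m A} {Q : Matrix n n A} (hP : IsStarProjection P)
    (hQ : IsStarProjection Q) :
    fcls (fromBlocks P 0 0 Q) (isStarProjection_fromBlocks hP hQ) = fcls P hP + fcls Q hQ := by
  rw [fcls, fcls, fcls, ← cls_directSum]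
  refine cls_eq_of_matEquiv (MatEquiv.trans (MatProj.isProj _) (MatProj.isProj _)
    (MatProj.matEquiv_ofFintype _ _).symm ?_)
  exact MatEquiv.trans (isStarProjection_fromBlocks hP hQ) (MatProj.isProj _)
    (MatEquiv.fromBlocks (MatProj.matEquiv_ofFintype P hP) (MatProj.matEquiv_ofFintype Q hQ))
    (MatProj.directSum_matEquiv _ _)

theorem fcls_add_of_mul_eq_zero {P Q R : Matrix n n A} (hP : IsStarProjection P)
    (hQ : IsStarProjection Q) (hR : IsStarProjection R) (hPQ : P * Q = 0) (h : P + Q = R) :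
    fcls R hR = fcls P hP + fcls Q hQ := by
  have hP1 : Pᴴ = P := hP.isSelfAdjoint
  have hP2 : P * P = P := hP.isIdempotentElem
  have hQ1 : Qᴴ = Q := hQ.isSelfAdjoint
  have hQ2 : Q * Q = Q := hQ.isIdempotentElem
  have hQP : Q * P = 0 := by simpa [hP1, hQ1] using congrArg conjTranspose hPQ
  rw [← fcls_fromBlocks]
  -- The row (P Q) is a partial isometry from P ⊕ Q onto P + Q.
  refine (fcls_eq_of_matEquiv _ _ ⟨fromCols P Q, ?_, ?_⟩).symm
  · rw [conjTranspose_fromCols_eq_fromRows_conjTranspose, fromRows_mul_fromCols, hP1, hQ1, hP2,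
      hQ2, hPQ, hQP]
  · rw [conjTranspose_fromCols_eq_fromRows_conjTranspose, fromCols_mul_fromRows, hP1, hQ1, hP2,
      hQ2, h]

/-- Murray-von Neumann subequivalence implies an inequality in `K_0`. -/
theorem fcls_le_fcls {P : Matrix m m A} {Q : Matrix n n A} (hP : IsStarProjection P)
    (hQ : IsStarProjection Q) (v : Matrix n m A) (hv : vᴴ * v = P) (hQv : Q * v = v) :
    fcls P hP ≤ fcls Q hQ := by
  have hP1 : Pᴴ = P := hP.isSelfAdjoint
  have hP2 : P * P = P := hP.isIdempotentElem
  have hQ1 : Qᴴ = Q := hQ.isSelfAdjoint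
  have hQ2 : Q * Q = Q := hQ.isIdempotentElem
  -- Cutting by P gives w P = w by pure algebra, with no norm on rectangular matrices. Then w w* is
  -- a subprojection of Q equivalent to P, and its complement in Q accounts for the inequality.
  set w := v * P
  have hw : wᴴ * w = P := by
    calc wᴴ * w = P * (vᴴ * v) * P := by
          simp only [w, conjTranspose_mul, hP1, Matrix.mul_assoc]
      _ = P := by rw [hv, hP2, hP2]
  have hwP : w * P = w := by simp only [w, Matrix.mul_assoc, hP2]
  have hQw : Q * w = w := by simp only [w, ← Matrix.mul_assoc, hQv]
  set E := w * wᴴ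
  have hE1 : Eᴴ = E := by simp [E, conjTranspose_mul]
  have hE2 : E * E = E := by
    calc E * E = w * (wᴴ * w) * wᴴ := by simp only [E, Matrix.mul_assoc]
      _ = E := by rw [hw, hwP]
  have hQE : Q * E = E := by simp only [E, ← Matrix.mul_assoc, hQw]
  have hEQ : E * Q = E := by simpa [hQ1, hE1] using congrArg conjTranspose hQE
  have hE : IsStarProjection E := ⟨hE2, hE1⟩
  have hD : IsStarProjection (Q - E) := by
    refine ⟨?_, ?_⟩
    · change (Q - E) * (Q - E) = Q - E
      rw [mul_sub, sub_mul, sub_mul, hQ2, hQE, hEQ, hE2, sub_self, sub_zero]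
    · change (Q - E)ᴴ = Q - E
      rw [conjTranspose_sub, hQ1, hE1]
  rw [fcls_eq_of_matEquiv hP hE ⟨w, hw, rfl⟩,
    fcls_add_of_mul_eq_zero hE hD hQ (by rw [mul_sub, hEQ, hE2, sub_self]) (add_sub_cancel E Q)]
  exact le_add_of_nonneg_right (fcls_nonneg hD)

theorem isStarProjection_diagonal [DecidableEq n] {q : A} (hq : IsStarProjection q) :
    IsStarProjection (diagonal fun _ : n => q) := by
  have h1 : star q = q := hq.isSelfAdjoint
  have h2 : q * q = q := hq.isIdempotentElem
  refine ⟨?_, ?_⟩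
  · change _ * _ = _
    rw [diagonal_mul_diagonal, h2]
  · change (_)ᴴ = _
    rw [diagonal_conjTranspose]
    exact congrArg diagonal (funext fun _ => h1)

/-- The class in `K_0(A)` of a projection in `A`. -/
noncomputable def pcls (q : A) (hq : IsStarProjection q) : K0 A :=
  fcls (diagonal fun _ : Fin 1 => q) (isStarProjection_diagonal hq)

theorem unitClass_eq_pcls : unitClass A = pcls 1 (IsStarProjection.one A) := by
  rw [unitClass, ← fcls_eq_cls, pcls]
  rfl

theorem pcls_eq_of_mvnEquiv {p q : A} (hp : IsStarProjection p) (hq : IsStarProjection q)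
    (h : MvNEquiv p q) : pcls p hp = pcls q hq := by
  obtain ⟨w, h1, h2⟩ := h
  refine fcls_eq_of_matEquiv _ _ ⟨diagonal fun _ => w, ?_, ?_⟩
  · rw [diagonal_conjTranspose, diagonal_mul_diagonal, ← h1]; rfl
  · rw [diagonal_conjTranspose, diagonal_mul_diagonal, ← h2]; rfl

theorem pcls_add_pcls_one_sub {p : A} (hp : IsStarProjection p) :
    unitClass A = pcls p hp + pcls (1 - p) hp.one_sub := by
  rw [unitClass_eq_pcls]
  refine fcls_add_of_mul_eq_zero _ _ _ ?_ ?_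
  · have : p * p = p := hp.isIdempotentElem
    simp [diagonal_mul_diagonal, mul_sub, this]
  · simp

theorem fcls_diagonal {q : A} (hq : IsStarProjection q) (k : ℕ) :
    fcls (diagonal fun _ : Fin k => q) (isStarProjection_diagonal hq) = k • pcls q hq := by
  induction k with
  | zero =>
    rw [zero_nsmul, ← map_zero (ofV (A := A))]
    exact cls_eq_of_matEquiv ⟨0, by ext i; exact i.elim0, by ext i; exact i.elim0⟩
  | succ k ih =>
    rw [succ_nsmul, ← ih, pcls, ← fcls_fromBlocks]
    refine (fcls_eq_of_matEquiv _ _ ?_).symm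
    have h := MatEquiv.submatrix (isStarProjection_fromBlocks
      (isStarProjection_diagonal (n := Fin k) hq) (isStarProjection_diagonal (n := Fin 1) hq))
      finSumFinEquiv.symm
    convert h using 1
    rw [fromBlocks_diagonal, submatrix_diagonal_equiv]
    congr 1
    ext i
    simp only [Function.comp_apply]
    cases finSumFinEquiv.symm i <;> rfl

/-- The relations say that the row (s₁ … s_k) is a partial isometry with initial projection diag(q,
…, q) and range under 1. -/
theorem nsmul_pcls_le_unitClass {q : A} (hq : IsStarProjection q) {k : ℕ} (s : Fin k → A)
    (hs : ∀ i j, star (s i) * s j = if i = j then q else 0) :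
    k • pcls q hq ≤ unitClass A := by
  rw [← fcls_diagonal, unitClass_eq_pcls]
  refine fcls_le_fcls _ _ (Matrix.of fun _ : Fin 1 => s) ?_ ?_
  · ext i j
    simp [Matrix.mul_apply, hs, diagonal_apply]
  · simp

end K0

end ProjectionClasses

/-! ### Comparison of nearby projections. -/

section Perturbation

open Matrix

/-- The element inside the norm is e x e - e p e; inserting e p e p e splits it into two errors,
each below 1/4. This makes e x e + e (1 - p) e invertible in the corner of e. -/
theorem norm_corner_sum_sub_lt_one {B : Type*} [CStarAlgebra B] {e p x : B}
    (he : IsStarProjection e) (hp : IsStarProjection p) (hc : ‖p * e - e * p‖ < 1 / 4)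
    (hx : ‖x - p * e * p‖ < 1 / 4) : ‖e * x * e + e * (1 - p) * e - e‖ < 1 := by
  have hee : e * e = e := he.isIdempotentElem
  have hpp : p * p = p := hp.isIdempotentElem
  have hen : ‖e‖ ≤ 1 := he.norm_le
  have hpn : ‖p‖ ≤ 1 := hp.norm_le
  have h : e * x * e + e * (1 - p) * e - e =
      e * (x - p * e * p) * e + e * (p * (e * p - p * e)) * e := by
    have h1 : e * (p * (e * p - p * e)) * e = e * (p * e * p) * e - e * p * e := by
      rw [mul_sub p, ← mul_assoc p p e, hpp, mul_sub e, sub_mul, ← mul_assoc p e p,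
        ← mul_assoc e p e, mul_assoc (e * p) e e, hee]
    rw [h1, mul_sub, sub_mul, mul_sub, mul_one, sub_mul, hee]
    abel
  have hle : ∀ y : B, ‖e * y * e‖ ≤ ‖y‖ := fun y => by
    calc ‖e * y * e‖ ≤ ‖e‖ * ‖y‖ * ‖e‖ :=
          (norm_mul_le _ _).trans (by gcongr; exact norm_mul_le _ _)
      _ ≤ 1 * ‖y‖ * 1 := by gcongr
      _ = ‖y‖ := by ring
  have h2 : ‖p * (e * p - p * e)‖ ≤ ‖p * e - e * p‖ := by
    rw [norm_sub_rev (p * e)]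
    calc _ ≤ ‖p‖ * ‖e * p - p * e‖ := norm_mul_le _ _
      _ ≤ 1 * ‖e * p - p * e‖ := by gcongr
      _ = _ := one_mul _
  rw [h]
  calc _ ≤ _ := norm_add_le _ _
    _ ≤ ‖x - p * e * p‖ + ‖p * e - e * p‖ := add_le_add (hle _) ((hle _).trans h2)
    _ < 1 := by linarith

variable {A : Type*} [CStarAlgebra A] [PartialOrder A] [StarOrderedRing A]

/-- The C*-norm on matrices is continuous for the entrywise topology, so continuity at 0 supplies δ.
-/
theorem CStarMatrix.exists_norm_lt_of_entries {n : Type*} [Fintype n] {c : ℝ} (hc : 0 < c) :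
    ∃ δ : ℝ, 0 < δ ∧ ∀ M : Matrix n n A, (∀ i j, ‖M i j‖ < δ) →
      ‖CStarMatrix.ofMatrix M‖ < c := by
  have hcont : Continuous fun M : n → n → A => ‖CStarMatrix.ofMatrixL (Matrix.of M)‖ :=
    continuous_norm.comp (CStarMatrix.ofMatrixL (A := A) (m := n) (n := n)).continuous
  have h0 := Metric.continuous_iff.mp hcont 0 c hc
  obtain ⟨δ, hδ, h⟩ := h0
  refine ⟨δ, hδ, fun M hM => ?_⟩
  have h1 := h (fun i j => M i j) ((dist_pi_lt_iff hδ).mpr fun i =>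
    (dist_pi_lt_iff hδ).mpr fun j => by simpa using hM i j)
  have h2 : CStarMatrix.ofMatrixL (Matrix.of (0 : n → n → A)) = 0 := map_zero _
  rwa [h2, norm_zero, Real.dist_eq, sub_zero, abs_norm] at h1

/-- Inverse square root for matrices over a C*-algebra. -/
theorem Matrix.exists_conj_eq_one {n : Type*} [Fintype n] [DecidableEq n] {T : Matrix n n A}
    (hT : Tᴴ = T) (h : ‖CStarMatrix.ofMatrix (T - 1)‖ < 1) :
    ∃ g : Matrix n n A, gᴴ = g ∧ g * T * g = 1 ∧ ∀ e, T * e = e * T → g * e = e * g := by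
  obtain ⟨g, h1, h2, h3⟩ := exists_selfAdjoint_conj_eq_one (B := CStarMatrix n n A)
    (T := CStarMatrix.ofMatrix T) hT (spectrum_pos_of_norm_sub_one_lt_one h)
  exact ⟨CStarMatrix.ofMatrix.symm g, h1, h2, fun e he => h3 (CStarMatrix.ofMatrix e) he⟩

/-- If `p` almost commutes with the entries of the projection `e`, and `p e p` is approximately
`r f r*`, then `e` is subequivalent to the sum of `f` and copies of `1 - p`. -/
theorem K0.exists_fcls_le_add (k : ℕ) : ∃ δ : ℝ, 0 < δ ∧
    ∀ (e f : Matrix (Fin k) (Fin k) A) (he : IsStarProjection e) (hf : IsStarProjection f)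
      (p r : A) (hp : IsStarProjection p), (∀ i j, ‖p * e i j - e i j * p‖ < δ) →
      (∀ i j, ‖r * f i j * star r - p * e i j * p‖ < δ) →
      K0.fcls e he ≤ K0.fcls f hf + k • K0.pcls (1 - p) hp.one_sub := by
  obtain ⟨δ, hδ, hδ'⟩ := CStarMatrix.exists_norm_lt_of_entries (A := A) (n := Fin k)
    (c := 1 / 4) (by norm_num)
  refine ⟨δ, hδ, fun e f he hf p r hp h1 h2 => ?_⟩
  set P : Matrix (Fin k) (Fin k) A := diagonal fun _ => p
  set R : Matrix (Fin k) (Fin k) A := diagonal fun _ => r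
  have hP : IsStarProjection P := isStarProjection_diagonal hp
  have hRs : Rᴴ = diagonal fun _ => star r := diagonal_conjTranspose _
  have he1 : eᴴ = e := he.isSelfAdjoint
  have he2 : e * e = e := he.isIdempotentElem
  have hf1 : fᴴ = f := hf.isSelfAdjoint
  have hf2 : f * f = f := hf.isIdempotentElem
  have hP1 : (1 - P)ᴴ = 1 - P := hP.one_sub.isSelfAdjoint
  have hP2 : (1 - P) * (1 - P) = 1 - P := hP.one_sub.isIdempotentElem
  have hc : ‖CStarMatrix.ofMatrix (P * e - e * P)‖ < 1 / 4 :=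
    hδ' _ fun i j => by simpa [P] using h1 i j
  have hx : ‖CStarMatrix.ofMatrix (R * f * Rᴴ - P * e * P)‖ < 1 / 4 :=
    hδ' _ fun i j => by simpa [P, R, hRs] using h2 i j
  -- S is close to e and equals t* t for the column t below, whose range lies under f ⊕ (1 - P).
  -- Since S + (1 - e) is close to 1, its inverse square root g exists and commutes with e, and t g
  -- is a partial isometry with initial projection e.
  set S := e * (R * f * Rᴴ) * e + e * (1 - P) * e
  have hS : ‖CStarMatrix.ofMatrix (S - e)‖ < 1 :=
    norm_corner_sum_sub_lt_one (B := CStarMatrix (Fin k) (Fin k) A)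
      (e := CStarMatrix.ofMatrix e) (p := CStarMatrix.ofMatrix P)
      (x := CStarMatrix.ofMatrix (R * f * Rᴴ)) ⟨he2, he1⟩
      ⟨hP.isIdempotentElem, hP.isSelfAdjoint⟩ hc hx
  have hSs : Sᴴ = S := by
    simp only [S, conjTranspose_add, conjTranspose_mul, conjTranspose_conjTranspose, he1, hf1, hP1,
      Matrix.mul_assoc]
  have heS : e * S = S := by simp only [S, mul_add, ← mul_assoc, he2]
  have hSe : S * e = S := by simp only [S, add_mul, mul_assoc, he2]
  obtain ⟨g, hg1, hg2, hg3⟩ := Matrix.exists_conj_eq_one (T := S + (1 - e))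
    (by rw [conjTranspose_add, hSs, conjTranspose_sub, conjTranspose_one, he1])
    (by rwa [show S + (1 - e) - 1 = S - e by abel])
  have hge : g * e = e * g := hg3 e (by
    rw [add_mul, mul_add, sub_mul, mul_sub, hSe, heS, mul_one, one_mul])
  set t : Matrix (Fin k ⊕ Fin k) (Fin k) A := fromRows (f * Rᴴ * e) ((1 - P) * e)
  have htt : tᴴ * t = S := by
    simp only [t, conjTranspose_fromRows_eq_fromCols_conjTranspose, fromCols_mul_fromRows,
      conjTranspose_mul, he1, hf1, hP1, conjTranspose_conjTranspose, S]
    congr 1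
    · calc _ = e * (R * (f * f) * Rᴴ) * e := by simp only [Matrix.mul_assoc]
        _ = _ := by rw [hf2]
    · calc _ = e * ((1 - P) * (1 - P)) * e := by simp only [Matrix.mul_assoc]
        _ = _ := by rw [hP2]
  have hdiag : (diagonal fun _ : Fin k => 1 - p) = 1 - P := by
    rw [← diagonal_one, diagonal_sub]
  rw [← K0.fcls_diagonal, ← K0.fcls_fromBlocks]
  refine K0.fcls_le_fcls _ _ (t * g) ?_ ?_
  · calc (t * g)ᴴ * (t * g) = g * (tᴴ * t) * g := by
          rw [conjTranspose_mul, hg1]; simp only [Matrix.mul_assoc]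
      _ = g * ((S + (1 - e)) * e) * g := by
          rw [htt, add_mul, hSe, sub_mul, he2, one_mul, sub_self, add_zero]
      _ = g * (S + (1 - e)) * g * e := by
          rw [mul_assoc _ g e, hge]; simp only [mul_assoc]
      _ = e := by rw [hg2, one_mul]
  · rw [hdiag, ← Matrix.mul_assoc]
    congr 1
    simp only [t, fromBlocks_mul_fromRows, ← Matrix.mul_assoc, hf2, hP2, Matrix.zero_mul, add_zero,
      zero_add]

end Perturbation

/-! ### The bound for one projection and the conclusion. -/

/-- The bound `[α(e)] - [e] ∈ [-k [1 - p₁], k [1 - p₁]]` for a projection `e` over `A`, when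
`p₁, p₂, v` witness approximate innerness on the entries of `e`. -/
theorem K0.exists_map_cls_sub_cls_le {A : Type*} [CStarAlgebra A] [PartialOrder A]
    [StarOrderedRing A] (k : ℕ) : ∃ δ : ℝ, 0 < δ ∧
    ∀ (α : A ≃⋆ₐ[ℂ] A) (e : MatProj A), e.size = k → ∀ (p₁ p₂ v : A) (hp₁ : IsStarProjection p₁),
      IsStarProjection p₂ → star v * v = p₁ → v * star v = α p₂ →
      (∀ i j, ‖p₁ * e.mat i j - e.mat i j * p₁‖ < δ ∧ ‖p₂ * e.mat i j - e.mat i j * p₂‖ < δ) →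
      (∀ i j, ‖v * p₁ * e.mat i j * p₁ * star v - α (p₂ * e.mat i j * p₂)‖ < δ) →
      K0.map (α : A →⋆ₐ[ℂ] A) (K0.cls e) - K0.cls e ≤ k • K0.pcls (1 - p₁) hp₁.one_sub ∧
      K0.cls e - K0.map (α : A →⋆ₐ[ℂ] A) (K0.cls e) ≤ k • K0.pcls (1 - p₁) hp₁.one_sub := by
  obtain ⟨δ, hδ, H⟩ := K0.exists_fcls_le_add (A := A) k
  refine ⟨δ, hδ, ?_⟩
  rintro α ⟨k, e, he⟩ rfl p₁ p₂ v hp₁ hp₂ hv hv' h1 h2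
  dsimp only at *
  have hαp : IsStarProjection (α p₂) :=
    ⟨by rw [IsIdempotentElem, ← map_mul, hp₂.isIdempotentElem.eq],
      by rw [isSelfAdjoint_iff, ← map_star, hp₂.isSelfAdjoint.star_eq]⟩
  have hpp : p₁ * p₁ = p₁ := hp₁.isIdempotentElem
  have hvp : v * p₁ = v := by
    rw [← sub_eq_zero, ← CStarRing.star_mul_self_eq_zero_iff]
    have : star (v * p₁ - v) = p₁ * star v - star v := by
      rw [star_sub, star_mul, hp₁.isSelfAdjoint.star_eq]
    calc star (v * p₁ - v) * (v * p₁ - v)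
        = p₁ * (star v * v) * p₁ - p₁ * (star v * v) - (star v * v) * p₁ + star v * v := by
          rw [this]; noncomm_ring
      _ = 0 := by rw [hv, hpp, hpp]; abel
  have hpv : p₁ * star v = star v := by
    simpa [hp₁.isSelfAdjoint.star_eq] using congrArg star hvp
  have hvn : ‖v‖ ≤ 1 := by
    have : ‖v‖ * ‖v‖ ≤ 1 := by
      rw [← CStarRing.norm_star_mul_self, hv]; exact hp₁.norm_le
    nlinarith [norm_nonneg v]
  have h3 : ∀ i j, ‖v * e i j * star v - α (p₂ * e i j * p₂)‖ < δ := fun i j => by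
    have := h2 i j
    rwa [hvp, mul_assoc _ p₁ (star v), hpv] at this
  set E : Matrix (Fin k) (Fin k) A := e.map α
  have hE : IsStarProjection E := (MatProj.map (α : A →⋆ₐ[ℂ] A) ⟨k, e, he⟩).isProj
  have hentry : ∀ i j, E i j = α (e i j) := fun i j => rfl
  -- As p₁ and α(p₂) are equivalent through v, cancellation in the group K₀ identifies the classes
  -- of their complements, even where the complements themselves need not be equivalent.
  have hcls : K0.pcls (1 - α p₂) hαp.one_sub = K0.pcls (1 - p₁) hp₁.one_sub := by
    have e1 := K0.pcls_add_pcls_one_sub hp₁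
    rw [K0.pcls_add_pcls_one_sub hαp, K0.pcls_eq_of_mvnEquiv hp₁ hαp ⟨v, hv, hv'⟩] at e1
    exact add_left_cancel e1
  have le1 := H E e hE he (α p₂) v hαp
    (fun i j => by
      rw [hentry, ← map_mul, ← map_mul, ← map_sub, StarAlgEquiv.norm_map]
      exact (h1 i j).2)
    (fun i j => by rw [hentry, ← map_mul, ← map_mul]; exact h3 i j)
  -- The reverse comparison uses v* in place of v: conjugating the estimate by v* turns v e v* into
  -- p₁ e p₁, and v* absorbs α(p₂) = v v*.
  have le2 := H e E he hE p₁ (star v) hp₁ (fun i j => (h1 i j).1) (fun i j => by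
    have hEq : star v * E i j * star (star v) - p₁ * e i j * p₁ =
        -(star v * (v * e i j * star v - α (p₂ * e i j * p₂)) * v) := by
      have ha : star v * (v * e i j * star v) * v = p₁ * e i j * p₁ := by
        rw [← hv]; simp only [mul_assoc]
      have hb : star v * α (p₂ * e i j * p₂) * v = star v * α (e i j) * v := by
        rw [map_mul, map_mul, ← hv']
        calc _ = (star v * v) * star v * α (e i j) * (v * (star v * v)) := by
              simp only [mul_assoc]
          _ = _ := by rw [hv, hpv, hvp]
      rw [mul_sub, sub_mul, ha, hb, star_star, hentry, neg_sub]
    rw [hEq, norm_neg]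
    calc _ ≤ ‖star v‖ * ‖v * e i j * star v - α (p₂ * e i j * p₂)‖ * ‖v‖ :=
          (norm_mul_le _ _).trans (by gcongr; exact norm_mul_le _ _)
      _ ≤ 1 * ‖v * e i j * star v - α (p₂ * e i j * p₂)‖ * 1 := by
          rw [norm_star]; gcongr
      _ < δ := by simpa using h3 i j)
  have hfc : K0.fcls e he = K0.cls ⟨k, e, he⟩ := K0.fcls_eq_cls ⟨k, e, he⟩
  have hfE : K0.fcls E hE = K0.map (α : A →⋆ₐ[ℂ] A) (K0.cls ⟨k, e, he⟩) :=
    (K0.fcls_eq_cls (MatProj.map (α : A →⋆ₐ[ℂ] A) ⟨k, e, he⟩)).trans (K0.map_cls _ _).symm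
  rw [hfc, hfE] at le1 le2
  rw [hcls] at le1
  exact ⟨sub_le_iff_le_add'.mpr le1, sub_le_iff_le_add'.mpr le2⟩

theorem mainTheorem5 {A : Type*} [CStarAlgebra A] [PartialOrder A] [StarOrderedRing A]
    [TopologicalSpace.SeparableSpace A] (hinf : ¬ FiniteDimensional ℂ A)
    (hsimple : IsSimpleCStar A) (α : A ≃⋆ₐ[ℂ] A) (hα : IsTraciallyApproxInner α) (η : K0 A) :
    IsInfinitesimal (K0.unitClass A) (K0.map (α : A →⋆ₐ[ℂ] A) η - η) := by
  classical
  intro m n hm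
  obtain ⟨e, f, rfl⟩ := K0.exists_eq_cls_sub_cls η
  obtain ⟨δ₁, hδ₁, H₁⟩ := K0.exists_map_cls_sub_cls_le (A := A) e.size
  obtain ⟨δ₂, hδ₂, H₂⟩ := K0.exists_map_cls_sub_cls_le (A := A) f.size
  -- e and f contribute size e and size f copies of [1 - p₁], and the difference is taken n times.
  -- Both x and the tolerances are fixed before p₁, p₂, v.
  obtain ⟨x, hx0, hx1, hx⟩ := hsimple.exists_small hinf (n * (e.size + f.size))
  obtain ⟨p₁, p₂, v, ⟨hp₁, hp₂, hv, hv'⟩, hF, hF', ⟨⟨q, hq, hqx, hpq⟩, -⟩, -⟩ :=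
    hα (Finset.univ.image (fun ij : Fin e.size × Fin e.size => e.mat ij.1 ij.2) ∪
      Finset.univ.image (fun ij : Fin f.size × Fin f.size => f.mat ij.1 ij.2))
      (min δ₁ δ₂) (lt_min hδ₁ hδ₂) x hx0 hx1
  obtain ⟨s, hs⟩ := hx q hq hqx
  have hbound := K0.nsmul_pcls_le_unitClass hq s hs
  rw [← K0.pcls_eq_of_mvnEquiv hp₁.one_sub hq hpq] at hbound
  have hem : ∀ i j, e.mat i j ∈ Finset.univ.image
      (fun ij : Fin e.size × Fin e.size => e.mat ij.1 ij.2) ∪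
      Finset.univ.image (fun ij : Fin f.size × Fin f.size => f.mat ij.1 ij.2) := fun i j =>
    Finset.mem_union_left _ (Finset.mem_image.mpr ⟨(i, j), Finset.mem_univ _, rfl⟩)
  have hfm : ∀ i j, f.mat i j ∈ Finset.univ.image
      (fun ij : Fin e.size × Fin e.size => e.mat ij.1 ij.2) ∪
      Finset.univ.image (fun ij : Fin f.size × Fin f.size => f.mat ij.1 ij.2) := fun i j =>
    Finset.mem_union_right _ (Finset.mem_image.mpr ⟨(i, j), Finset.mem_univ _, rfl⟩)
  obtain ⟨he1, he2⟩ := H₁ α e rfl p₁ p₂ v hp₁ hp₂ hv hv'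
    (fun i j => ⟨(hF _ (hem i j)).1.trans_le (min_le_left _ _),
      (hF _ (hem i j)).2.trans_le (min_le_left _ _)⟩)
    (fun i j => (hF' _ (hem i j)).trans_le (min_le_left _ _))
  obtain ⟨hf1, hf2⟩ := H₂ α f rfl p₁ p₂ v hp₁ hp₂ hv hv'
    (fun i j => ⟨(hF _ (hfm i j)).1.trans_le (min_le_right _ _),
      (hF _ (hfm i j)).2.trans_le (min_le_right _ _)⟩)
    (fun i j => (hF' _ (hfm i j)).trans_le (min_le_right _ _))
  set c := K0.pcls (1 - p₁) hp₁.one_sub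
  -- The bound by [1] is independent of m; positivity of m enters only here.
  have hu : K0.unitClass A ≤ m • K0.unitClass A :=
    le_self_nsmul (K0.cls_nonneg _) hm.ne'
  have hcm : n • ((e.size + f.size) • c) ≤ m • K0.unitClass A := by
    rw [← mul_nsmul']
    exact hbound.trans hu
  rw [map_sub]
  constructor
  · rw [neg_le, ← neg_nsmul]
    refine le_trans (nsmul_le_nsmul_right ?_ n) hcm
    calc _ = (K0.cls e - K0.map (α : A →⋆ₐ[ℂ] A) (K0.cls e)) +
          (K0.map (α : A →⋆ₐ[ℂ] A) (K0.cls f) - K0.cls f) := by abel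
      _ ≤ e.size • c + f.size • c := add_le_add he2 hf1
      _ = _ := (add_nsmul _ _ _).symm
  · refine le_trans (nsmul_le_nsmul_right ?_ n) hcm
    calc _ = (K0.map (α : A →⋆ₐ[ℂ] A) (K0.cls e) - K0.cls e) +
          (K0.cls f - K0.map (α : A →⋆ₐ[ℂ] A) (K0.cls f)) := by abel
      _ ≤ e.size • c + f.size • c := add_le_add he1 hf2
      _ = _ := (add_nsmul _ _ _).symm
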